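/- Let $m\ge 0$, let $a_1,\dots,a_m$ be the annihilation operators on the $2^m$-dimensional Fock space with occupation basis $|b\rangle$, $b\in\{0,1\}^m$ (so $a_i|x\rangle=(-1)^{\sum_{j<i}x_j}|x-e_i\rangle$ if $x_i=1$ and $a_i|x\rangle=0$ otherwise), let $\gamma_{2i-1}=a_i+a_i^\dagger$ and $\gamma_{2i}=-i(a_i-a_i^\dagger)$ be the Majorana operators, and for $\mu=\{\mu_1<\dots<\mu_k\}\subseteq\{1,\dots,2m\}$ let $\Gamma_\mu=(-i)^{\binom k2}\gamma_{\mu_1}\cdots\gamma_{\mu_k}$. For each permutation $p$ of $\{1,\dots,2m\}$ let $U(p)$ be the unitary (unique up to phase) with $U(p)\gamma_jU(p)^\dagger=\gamma_{p(j)}$ for all $j$, and let $P_{p,b}=U(p)^\dagger|b\rangle\langle b|U(p)$. The channel of this ensemble is $$\mathcal M(X)=\frac1{(2m)!}\sum_{p}\sum_{b\in\{0,1\}^m}\operatorname{tr}(XP_{p,b})\,P_{p,b}.$$ Let $V$ be the linear span of the $\Gamma_\mu$ with $|\mu|$ even. Then $\mathcal M$ maps $V$ bijectively onto $V$; write $\mathcal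 M^{-1}$ for the inverse on $V$, which contains every $P_{p,b}$. For an operator $O$, let $\hat o_{p,b}=\operatorname{tr}\big(O\,\mathcal M^{-1}(P_{p,b})\big)$ and define the shadow norm by $$\|O\|_{\mathcal U}^2=\max_{\sigma}\ \frac1{(2m)!}\sum_{p}\sum_{b}\operatorname{tr}(\sigma P_{p,b})\,|\hat o_{p,b}|^2,$$ the maximum being over all density matrices $\sigma$ ($\hat o_{p,b}$ is real when $O$ is Hermitian). For every even operator $H=\sum_{|\mu|\text{ even}}h_\mu\Gamma_\mu$ with coefficients $h_\mu\in\mathbb C$ (in particular for every even observable, i.e. when all $h_\mu$ are real), $$\|H\|_{\mathcal U}^2\ \le\ \sum_{\substack{|\mu|,\,|\mu'|\ \text{even}\\ |\mu\cap\mu'|\ \text{even}}}|h_\mu|\,|h_{\mu'}|\,\kappa_{m,\mu,\mu'},$$ where, with $k=|\mu|/2$, $k'=|\mu'|/2$, $a=|\mu\cap\mu'|/2$, $$\kappa_{m,\mu,\mu'}=\frac{\lambda_{m,k,k',a}}{\lambda_{m,k}\,\lambda_{m,k'}},\qquad \lambda_{m,k}=\frac{\binom mk}{\binom{2m}{2k}},\qquad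 \lambda_{m,k,k',a}=\frac{\binom{m}{a,\;k-a,\;k'-a,\;m-k-k'+a}}{\binom{2m}{2a,\;2(k-a),\;2(k'-a),\;2(m-k-k'+a)}}.$$ -/

import Mathlib

namespace FermionicShadows
noncomputable section

/-- Operators on the `2 ^ m`-dimensional Fock space of `m` modes, as matrices in the occupation
basis `|x⟩`, `x : Fin m → Bool`. -/
abbrev Op (m : ℕ) : Type := Matrix (Fin m → Bool) (Fin m → Bool) ℂ

/-- The sign `(-1) ^ (∑_{j < i} x_j)`. -/
def jwSign {m : ℕ} (i : Fin m) (x : Fin m → Bool) : ℂ :=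
  (-1) ^ (Finset.univ.filter fun j : Fin m => j < i ∧ x j = true).card

/-- The annihilation operator `a_i`: `a_i |x⟩ = (-1) ^ (∑_{j < i} x_j) |x with x_i = 0⟩` if
`x_i = 1`, and `a_i |x⟩ = 0` if `x_i = 0`. -/
def annihilation {m : ℕ} (i : Fin m) : Op m :=
  Matrix.of fun y x =>
    if x i = true ∧ y = Function.update x i false then jwSign i x else 0

/-- The mode `⌊k / 2⌋` to which the `k`-th Majorana operator belongs (indices from `0`). -/
def modeOf {m : ℕ} (k : Fin (2 * m)) : Fin m := ⟨k.val / 2, by omega⟩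

/-- The single-mode Majorana operators, indexed from `0`: the operator with index `2 i` is
`a_i + a_i†` and the one with index `2 i + 1` is `-i (a_i - a_i†)`. -/
def majorana {m : ℕ} (k : Fin (2 * m)) : Op m :=
  if k.val % 2 = 0 then annihilation (modeOf k) + (annihilation (modeOf k)).conjTranspose
  else (-Complex.I) • (annihilation (modeOf k) - (annihilation (modeOf k)).conjTranspose)

/-- The Majorana operator `Γ_μ = (-i) ^ (k choose 2) γ_{μ_1} ⋯ γ_{μ_k}` of an increasing index
sequence `μ_1 < ⋯ < μ_k`, that is, of a finite set `μ` of `k` indices. -/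
def majoranaProd {m : ℕ} (μ : Finset (Fin (2 * m))) : Op m :=
  (-Complex.I) ^ (μ.card.choose 2) • ((μ.sort (· ≤ ·)).map majorana).prod

/-- The bit string `x` with its `i`-th bit flipped. -/
def flipAt {m : ℕ} (i : Fin m) (x : Fin m → Bool) : Fin m → Bool := Function.update x i (!x i)

/-- The entry of `majorana k` in column `x` and row `flipAt (modeOf k) x`, its only nonzero one. -/
def majCoeff {m : ℕ} (k : Fin (2 * m)) (x : Fin m → Bool) : ℂ :=
  jwSign (modeOf k) x *
    (if k.val % 2 = 0 then 1 else if x (modeOf k) = true then -Complex.I else Complex.I)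

lemma flipAt_flipAt {m : ℕ} (i : Fin m) (x : Fin m → Bool) : flipAt i (flipAt i x) = x := by
  simp [flipAt]

lemma flipAt_comm {m : ℕ} (i j : Fin m) (x : Fin m → Bool) :
    flipAt i (flipAt j x) = flipAt j (flipAt i x) := by
  by_cases h : i = j
  · subst h; rfl
  · unfold flipAt
    rw [Function.update_of_ne h, Function.update_of_ne (Ne.symm h), Function.update_comm h]

lemma eq_flipAt_iff {m : ℕ} (i : Fin m) (x y : Fin m → Bool) : y = flipAt i x ↔ x = flipAt i y := by
  constructor <;> (rintro rfl; rw [flipAt_flipAt])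

lemma jwSign_flipAt_of_le {m : ℕ} {i j : Fin m} (h : i ≤ j) (x : Fin m → Bool) :
    jwSign i (flipAt j x) = jwSign i x := by
  unfold jwSign
  congr 2
  refine Finset.filter_congr fun l _ => and_congr_right fun h1 => ?_
  rw [flipAt, Function.update_of_ne (ne_of_lt (lt_of_lt_of_le h1 h))]

lemma jwSign_eq_prod {m : ℕ} (i : Fin m) (x : Fin m → Bool) :
    jwSign i x = ∏ j, (if j < i ∧ x j = true then (-1 : ℂ) else 1) := by
  rw [Finset.prod_ite]
  simp [jwSign]

lemma jwSign_flipAt_of_lt {m : ℕ} {i j : Fin m} (h : j < i) (x : Fin m → Bool) :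
    jwSign i (flipAt j x) = - jwSign i x := by
  rw [jwSign_eq_prod, jwSign_eq_prod, ← Finset.mul_prod_erase _ _ (Finset.mem_univ j),
    ← Finset.mul_prod_erase Finset.univ (fun l => if l < i ∧ x l = true then (-1 : ℂ) else 1)
      (Finset.mem_univ j)]
  have : ∏ l ∈ Finset.univ.erase j, (if l < i ∧ flipAt j x l = true then (-1 : ℂ) else 1) =
      ∏ l ∈ Finset.univ.erase j, (if l < i ∧ x l = true then (-1 : ℂ) else 1) := by
    refine Finset.prod_congr rfl fun l hl => ?_
    rw [flipAt, Function.update_of_ne (Finset.ne_of_mem_erase hl)]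
  rw [this]
  cases hx : x j <;> simp [flipAt, h, hx]

lemma jwSign_mul_self {m : ℕ} (i : Fin m) (x : Fin m → Bool) : jwSign i x * jwSign i x = 1 := by
  unfold jwSign
  rw [← mul_pow]; simp

lemma star_jwSign {m : ℕ} (i : Fin m) (x : Fin m → Bool) : star (jwSign i x) = jwSign i x := by
  simp [jwSign]

lemma majorana_apply {m : ℕ} (k : Fin (2 * m)) (y x : Fin m → Bool) :
    majorana k y x = if y = flipAt (modeOf k) x then majCoeff k x else 0 := by
  have e1 : annihilation (modeOf k) y x =
      if y = flipAt (modeOf k) x then (if x (modeOf k) = true then jwSign (modeOf k) x else 0)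
      else 0 := by
    cases hx : x (modeOf k) <;> simp [annihilation, flipAt, hx]
  have e2 : star (annihilation (modeOf k) x y) =
      if y = flipAt (modeOf k) x then (if x (modeOf k) = true then 0 else jwSign (modeOf k) x)
      else 0 := by
    by_cases hy : y = flipAt (modeOf k) x
    · have h2 : x = flipAt (modeOf k) y := (eq_flipAt_iff _ _ _).1 hy
      have hs : jwSign (modeOf k) y = jwSign (modeOf k) x := by
        rw [hy, jwSign_flipAt_of_le le_rfl]
      have hyk : y (modeOf k) = !x (modeOf k) := by rw [hy]; simp [flipAt]
      rw [if_pos hy]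
      cases hx : x (modeOf k)
      · rw [hx] at hyk
        have : x = Function.update y (modeOf k) false := by
          conv_lhs => rw [h2]
          simp [flipAt, hyk]
        simp only [annihilation, Matrix.of_apply]
        rw [if_pos ⟨by simpa using hyk, this⟩, star_jwSign, hs]; simp
      · rw [hx] at hyk
        simp [annihilation, hyk]
    · rw [if_neg hy]
      simp only [annihilation, Matrix.of_apply]
      rw [if_neg, star_zero]
      rintro ⟨h1, h2⟩
      apply hy
      rw [eq_flipAt_iff, h2]
      simp [flipAt, h1]
  unfold majorana majCoeff
  by_cases hk : k.val % 2 = 0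
  · rw [if_pos hk, Matrix.add_apply, Matrix.conjTranspose_apply, e1, e2, if_pos hk]
    by_cases hy : y = flipAt (modeOf k) x <;> cases hx : x (modeOf k) <;> simp [hy]
  · rw [if_neg hk, Matrix.smul_apply, Matrix.sub_apply, Matrix.conjTranspose_apply, e1, e2,
      if_neg hk]
    by_cases hy : y = flipAt (modeOf k) x <;> cases hx : x (modeOf k) <;> simp [hy, mul_comm]

lemma majorana_mul_apply {m : ℕ} (k l : Fin (2 * m)) (y x : Fin m → Bool) :
    (majorana k * majorana l) y x = if y = flipAt (modeOf k) (flipAt (modeOf l) x) then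
      majCoeff k (flipAt (modeOf l) x) * majCoeff l x else 0 := by
  rw [Matrix.mul_apply, Finset.sum_eq_single (flipAt (modeOf l) x)]
  · simp only [majorana_apply]
    split_ifs <;> simp
  · intro z _ hz
    simp [majorana_apply, hz]
  · simp

lemma majCoeff_flipAt_of_lt {m : ℕ} {k l : Fin (2 * m)} (h : modeOf k < modeOf l)
    (x : Fin m → Bool) : majCoeff k (flipAt (modeOf l) x) = majCoeff k x := by
  unfold majCoeff
  rw [jwSign_flipAt_of_le h.le]
  simp [flipAt, Function.update_of_ne h.ne]

lemma majCoeff_flipAt_of_gt {m : ℕ} {k l : Fin (2 * m)} (h : modeOf l < modeOf k)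
    (x : Fin m → Bool) : majCoeff k (flipAt (modeOf l) x) = - majCoeff k x := by
  unfold majCoeff
  rw [jwSign_flipAt_of_lt h, neg_mul, flipAt, Function.update_of_ne h.ne']

lemma majorana_mul_self {m : ℕ} (k : Fin (2 * m)) : majorana k * majorana k = 1 := by
  ext y x
  rw [majorana_mul_apply, flipAt_flipAt, Matrix.one_apply]
  refine if_congr Iff.rfl ?_ rfl
  unfold majCoeff
  rw [jwSign_flipAt_of_le le_rfl, mul_mul_mul_comm, jwSign_mul_self, one_mul]
  cases hx : x (modeOf k) <;> by_cases hk : k.val % 2 = 0 <;> simp [hk, hx, flipAt]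

lemma majorana_anticomm {m : ℕ} {k l : Fin (2 * m)} (h : k ≠ l) :
    majorana k * majorana l = -(majorana l * majorana k) := by
  ext y x
  rw [Matrix.neg_apply, majorana_mul_apply, majorana_mul_apply, flipAt_comm]
  split_ifs
  swap
  · simp
  rcases lt_trichotomy (modeOf k) (modeOf l) with hlt | heq | hgt
  · rw [majCoeff_flipAt_of_lt hlt, majCoeff_flipAt_of_gt hlt]; ring
  · have h2 : k.val % 2 ≠ l.val % 2 := by
      intro h3
      apply h
      have h4 : k.val / 2 = l.val / 2 := congrArg Fin.val heq
      ext; omega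
    unfold majCoeff
    rw [heq, jwSign_flipAt_of_le le_rfl]
    rcases Nat.mod_two_eq_zero_or_one k.val with hk | hk <;>
      rcases Nat.mod_two_eq_zero_or_one l.val with hl | hl <;>
      cases hx : x (modeOf l) <;> simp_all [flipAt, mul_comm]
  · rw [majCoeff_flipAt_of_lt hgt, majCoeff_flipAt_of_gt hgt]; ring

lemma majorana_conjTranspose {m : ℕ} (k : Fin (2 * m)) :
    (majorana k).conjTranspose = majorana k := by
  unfold majorana
  split_ifs
  · simp [add_comm]
  · simp [sub_eq_add_neg, add_comm]

/-- The parity operator, the diagonal matrix with entries `(-1) ^ (∑_j x_j)`. -/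
def parity (m : ℕ) : Op m := Matrix.diagonal fun x => ∏ j, (if x j = true then (-1 : ℂ) else 1)

lemma parity_mul_self (m : ℕ) : parity m * parity m = 1 := by
  rw [parity, Matrix.diagonal_mul_diagonal, ← Matrix.diagonal_one]
  congr 1
  ext x
  rw [← Finset.prod_mul_distrib]
  refine Finset.prod_eq_one fun j _ => ?_
  split_ifs <;> simp

lemma parity_conjTranspose (m : ℕ) : (parity m).conjTranspose = parity m := by
  rw [parity, Matrix.diagonal_conjTranspose]
  congr 1
  ext x
  rw [Pi.star_apply, star_prod]
  refine Finset.prod_congr rfl fun j _ => ?_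
  split_ifs <;> simp

lemma parity_mul_majorana {m : ℕ} (k : Fin (2 * m)) :
    parity m * majorana k = -(majorana k * parity m) := by
  ext y x
  rw [Matrix.neg_apply, parity, Matrix.diagonal_mul, Matrix.mul_diagonal, majorana_apply]
  split_ifs with hy
  swap
  · simp
  subst hy
  rw [← Finset.mul_prod_erase _ _ (Finset.mem_univ (modeOf k)),
    ← Finset.mul_prod_erase Finset.univ (fun l => if x l = true then (-1 : ℂ) else 1)
      (Finset.mem_univ (modeOf k))]
  have : ∏ l ∈ Finset.univ.erase (modeOf k), (if flipAt (modeOf k) x l = true then (-1 : ℂ) else 1)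
      = ∏ l ∈ Finset.univ.erase (modeOf k), (if x l = true then (-1 : ℂ) else 1) := by
    refine Finset.prod_congr rfl fun l hl => ?_
    rw [flipAt, Function.update_of_ne (Finset.ne_of_mem_erase hl)]
  rw [this]
  cases hx : x (modeOf k) <;> simp [flipAt, hx] <;> ring

lemma exists_swapUnitary {m : ℕ} {i j : Fin (2 * m)} (hij : i ≠ j) :
    ∃ V : Op m, V * V.conjTranspose = 1 ∧
      ∀ k, V * majorana k * V.conjTranspose = majorana (Equiv.swap i j k) := by
  set c : ℂ := ((√2 : ℝ) : ℂ)⁻¹ with hc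
  have hcc : c * c = 1 / 2 := by
    rw [hc, ← mul_inv, ← Complex.ofReal_mul, Real.mul_self_sqrt (by norm_num)]; norm_num
  have hsc : star c = c := by
    rw [hc]; simp
  set D : Op m := majorana i - majorana j with hD
  have hDh : D.conjTranspose = D := by simp [hD, majorana_conjTranspose]
  have hii := majorana_mul_self i
  have hjj := majorana_mul_self j
  have hji : majorana j * majorana i = -(majorana i * majorana j) := majorana_anticomm hij.symm
  have hDD : D * D = (2 : ℂ) • 1 := by
    rw [hD, sub_mul, mul_sub, mul_sub, hii, hjj, hji, two_smul]; abel
  have hV : (c • (parity m * D)).conjTranspose = c • (D * parity m) := by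
    rw [Matrix.conjTranspose_smul, Matrix.conjTranspose_mul, hDh, parity_conjTranspose, hsc]
  have hZD : ∀ k : Fin (2 * m), parity m * majorana k * parity m = -majorana k := by
    intro k
    rw [parity_mul_majorana, neg_mul, mul_assoc, parity_mul_self, mul_one]
  have key : ∀ X : Op m, (c • (parity m * D)) * X * (c • (D * parity m)) =
      (1 / 2 : ℂ) • (parity m * (D * X * D) * parity m) := by
    intro X
    rw [smul_mul_assoc, smul_mul_assoc, mul_smul_comm, smul_smul, hcc]
    simp only [mul_assoc]
  refine ⟨c • (parity m * D), ?_, fun k => ?_⟩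
  · rw [hV]
    have := key 1
    rw [mul_one, mul_one, hDD] at this
    rw [this, mul_smul_comm, smul_mul_assoc, mul_one, parity_mul_self, smul_smul]
    norm_num
  · rw [hV, key]
    have hDkD : D * majorana k * D = (-2 : ℂ) • majorana (Equiv.swap i j k) := by
      by_cases hki : k = i
      · subst hki
        rw [Equiv.swap_apply_left]
        have : D * majorana k * D = majorana k * majorana k * majorana k
            - majorana k * majorana k * majorana j - majorana j * (majorana k * majorana k)
            + majorana j * majorana k * majorana j := by rw [hD]; noncomm_ring
        rw [this, hji, hii, neg_mul, mul_assoc (majorana k) (majorana j), hjj, mul_one, one_mul,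
          one_mul, mul_one, neg_smul, two_smul]
        abel
      by_cases hkj : k = j
      · subst hkj
        rw [Equiv.swap_apply_right]
        have : D * majorana k * D = majorana i * majorana k * majorana i
            - majorana i * (majorana k * majorana k) - majorana k * majorana k * majorana i
            + majorana k * majorana k * majorana k := by rw [hD]; noncomm_ring
        rw [this, mul_assoc (majorana i) (majorana k) (majorana i), hji, mul_neg, ← mul_assoc, hii,
          hjj, mul_one, one_mul, one_mul, neg_smul, two_smul]
        abel
      · rw [Equiv.swap_apply_of_ne_of_ne hki hkj]
        have h1 : D * majorana k = -(majorana k * D) := by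
          rw [hD, sub_mul, mul_sub, majorana_anticomm (Ne.symm hki),
            majorana_anticomm (Ne.symm hkj)]
          abel
        rw [h1, neg_mul, mul_assoc, hDD, mul_smul_comm, mul_one, neg_smul]
    rw [hDkD, mul_smul_comm, smul_mul_assoc, hZD, smul_smul, smul_neg]
    norm_num

/-- Every permutation of the single-mode Majorana operators is implemented by a unitary. -/
theorem exists_majoranaUnitary {m : ℕ} (p : Equiv.Perm (Fin (2 * m))) :
    ∃ V : Op m, V ∈ Matrix.unitaryGroup (Fin m → Bool) ℂ ∧
      ∀ k, V * majorana k * V.conjTranspose = majorana (p k) := by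
  suffices h : ∃ V : Op m, V * V.conjTranspose = 1 ∧
      ∀ k, V * majorana k * V.conjTranspose = majorana (p k) by
    obtain ⟨V, h1, h2⟩ := h
    exact ⟨V, Matrix.mem_unitaryGroup_iff.2 h1, h2⟩
  induction p using Equiv.Perm.swap_induction_on with
  | one => exact ⟨1, by simp, by simp⟩
  | swap_mul f i j hij ih =>
    obtain ⟨V, hV1, hV2⟩ := ih
    obtain ⟨W, hW1, hW2⟩ := exists_swapUnitary hij
    refine ⟨W * V, ?_, fun k => ?_⟩
    · rw [Matrix.conjTranspose_mul, mul_assoc, ← mul_assoc V, hV1, one_mul, hW1]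
    · rw [Matrix.conjTranspose_mul, Equiv.Perm.mul_apply, ← hW2, ← hV2]
      simp only [mul_assoc]

/-- The unitary `U(p)` of the affine-matchgate ensemble attached to a permutation `p` of the `2 m`
single-mode Majorana operators, with `U(p) γ_k U(p)† = γ_{p(k)}`. This relation determines `U(p)`
up to a global phase, which cancels in every expression below. -/
def ensembleUnitary {m : ℕ} (p : Equiv.Perm (Fin (2 * m))) : Op m :=
  Classical.choose (exists_majoranaUnitary p)

lemma ensembleUnitary_mem {m : ℕ} (p : Equiv.Perm (Fin (2 * m))) :
    ensembleUnitary p ∈ Matrix.unitaryGroup (Fin m → Bool) ℂ :=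
  (Classical.choose_spec (exists_majoranaUnitary p)).1

lemma ensembleUnitary_conj {m : ℕ} (p : Equiv.Perm (Fin (2 * m))) (k : Fin (2 * m)) :
    ensembleUnitary p * majorana k * (ensembleUnitary p).conjTranspose = majorana (p k) :=
  (Classical.choose_spec (exists_majoranaUnitary p)).2 k

/-- The snapshot `U(p)† |b⟩⟨b| U(p)` of the outcome `b` in the basis `U(p)`. -/
def snapshot {m : ℕ} (p : Equiv.Perm (Fin (2 * m))) (b : Fin m → Bool) : Op m :=
  (ensembleUnitary p).conjTranspose * Matrix.single b b (1 : ℂ) * ensembleUnitary p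

/-- The measurement channel
`M(X) = 1 / (2 m)! ∑_p ∑_b tr(X U(p)† |b⟩⟨b| U(p)) U(p)† |b⟩⟨b| U(p)`. -/
def channel {m : ℕ} (X : Op m) : Op m :=
  ((Nat.factorial (2 * m) : ℂ))⁻¹ • ∑ p : Equiv.Perm (Fin (2 * m)), ∑ b : Fin m → Bool,
    (X * snapshot p b).trace • snapshot p b

/-- The span of the Majorana operators of even degree. -/
def evenSubspace (m : ℕ) : Submodule ℂ (Op m) :=
  Submodule.span ℂ {X | ∃ μ : Finset (Fin (2 * m)), Even μ.card ∧ X = majoranaProd μ}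

/-- The inverse of the channel on the even-degree subspace: for even `X`, the even operator `Y`
with `M(Y) = X`. -/
def channelInv {m : ℕ} (X : Op m) : Op m :=
  Function.invFunOn channel (evenSubspace m : Set (Op m)) X

/-- The value `tr(O M⁻¹(U(p)† |b⟩⟨b| U(p)))` of the estimator `ô`. -/
def estimator {m : ℕ} (O : Op m) (p : Equiv.Perm (Fin (2 * m))) (b : Fin m → Bool) : ℂ :=
  (O * channelInv (snapshot p b)).trace

/-- The probability `⟨b| U(p) σ U(p)† |b⟩` of the outcome `b` given `p`, on the state `σ`. -/
def outcomeProb {m : ℕ} (σ : Op m) (p : Equiv.Perm (Fin (2 * m))) (b : Fin m → Bool) : ℝ :=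
  (σ * snapshot p b).trace.re

/-- The second moment `E |ô|²` of the estimator on the state `σ`, for `p` uniformly random and `b`
distributed according to the measurement outcome. (For Hermitian `O` the estimator is real and
this is `E ô²`.) -/
def secondMoment {m : ℕ} (O σ : Op m) : ℝ :=
  ((Nat.factorial (2 * m) : ℝ))⁻¹ * ∑ p : Equiv.Perm (Fin (2 * m)), ∑ b : Fin m → Bool,
    outcomeProb σ p b * ‖estimator O p b‖ ^ 2

open scoped ComplexOrder in
/-- The normalized states (density matrices). -/
def states (m : ℕ) : Set (Op m) := {σ | σ.PosSemidef ∧ σ.trace = 1}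

/-- The shadow norm: the maximum over all normalized states of the root mean square of the
estimator. -/
def shadowNorm {m : ℕ} (O : Op m) : ℝ := √(sSup (secondMoment O '' states m))

open scoped ComplexOrder in
lemma norm_apply_le_of_mem_states {m : ℕ} {σ : Op m} (hσ : σ ∈ states m) (x y : Fin m → Bool) :
    ‖σ x y‖ ≤ 2 := by
  obtain ⟨hP, ht⟩ := hσ
  have hd : ∀ z, 0 ≤ (σ z z).re := fun z => (Complex.nonneg_iff.1 (hP.diag_nonneg (i := z))).1
  have hsum : ∑ z, (σ z z).re = 1 := by
    have := congrArg Complex.re ht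
    simpa [Matrix.trace] using this
  have hle : ∀ z, (σ z z).re ≤ 1 := fun z => by
    rw [← hsum]
    exact Finset.single_le_sum (f := fun z => (σ z z).re) (fun i _ => hd i) (Finset.mem_univ z)
  have hq : ∀ c : ℂ, 0 ≤ (σ x x).re + (star c * σ y x).re + (c * σ x y).re
      + (star c * c * σ y y).re := by
    intro c
    have h := hP.dotProduct_mulVec_nonneg (Pi.single x 1 + Pi.single y c)
    have h2 := (Complex.nonneg_iff.1 h).1
    have e : star (Pi.single x 1 + Pi.single y c : (Fin m → Bool) → ℂ) ⬝ᵥ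
        (σ.mulVec (Pi.single x 1 + Pi.single y c)) =
        σ x x + star c * σ y x + c * σ x y + star c * c * σ y y := by
      rw [star_add, Pi.star_single, Pi.star_single, Matrix.mulVec_add, add_dotProduct,
        dotProduct_add, dotProduct_add]
      simp only [single_dotProduct, Matrix.mulVec_single, Pi.smul_apply, Matrix.col_apply,
        MulOpposite.smul_eq_mul_unop, MulOpposite.unop_op, star_one]
      ring
    rw [e] at h2
    simpa using h2
  have hyx : σ y x = star (σ x y) := (hP.1.apply x y).symm ▸ by simp
  have h1 := hq 1
  have h2 := hq (-1)
  have h3 := hq Complex.I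
  have h4 := hq (-Complex.I)
  have hx := hle x
  have hy := hle y
  simp [hyx] at h1 h2 h3 h4
  have hre : |(σ x y).re| ≤ 1 := by rw [abs_le]; constructor <;> linarith
  have him : |(σ x y).im| ≤ 1 := by rw [abs_le]; constructor <;> linarith
  linarith [Complex.norm_le_abs_re_add_abs_im (σ x y)]

open scoped ComplexOrder in
lemma isCompact_states (m : ℕ) : IsCompact (states m) := by
  have hK : IsCompact (Set.pi Set.univ fun _ : Fin m → Bool => Set.pi Set.univ
      fun _ : Fin m → Bool => Metric.closedBall (0 : ℂ) 2) :=
    isCompact_univ_pi fun _ => isCompact_univ_pi fun _ => isCompact_closedBall _ _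
  have hcl : IsClosed (states m) := by
    have : states m = {σ : Op m | σ.conjTranspose = σ} ∩
        (⋂ v : (Fin m → Bool) → ℂ, {σ : Op m | 0 ≤ star v ⬝ᵥ (σ.mulVec v)}) ∩
        {σ : Op m | σ.trace = 1} := by
      ext σ
      simp [states, Matrix.posSemidef_iff_dotProduct_mulVec, Matrix.IsHermitian]
    rw [this]
    refine IsClosed.inter (IsClosed.inter ?_ (isClosed_iInter fun v => ?_)) ?_
    · exact isClosed_eq (by fun_prop) continuous_id
    · exact isClosed_le continuous_const (by fun_prop)
    · exact isClosed_eq (by fun_prop) continuous_const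
  refine IsCompact.of_isClosed_subset (X := (Fin m → Bool) → (Fin m → Bool) → ℂ) hK hcl ?_
  intro σ hσ x _ y _
  simpa using norm_apply_le_of_mem_states hσ x y

open scoped ComplexOrder in
lemma states_nonempty (m : ℕ) : (states m).Nonempty := by
  refine ⟨Matrix.diagonal (Pi.single (fun _ => false) 1), Matrix.PosSemidef.diagonal ?_, ?_⟩
  · intro x
    by_cases h : x = fun _ => false
    · subst h; simp
    · simp [Pi.single_eq_of_ne h]
  · simp [Matrix.trace_diagonal]

open scoped ComplexOrder in
lemma outcomeProb_nonneg {m : ℕ} {σ : Op m} (hσ : σ ∈ states m) (p : Equiv.Perm (Fin (2 * m)))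
    (b : Fin m → Bool) : 0 ≤ outcomeProb σ p b := by
  have h : (ensembleUnitary p * σ * (ensembleUnitary p).conjTranspose).PosSemidef :=
    hσ.1.mul_mul_conjTranspose_same _
  have e : (σ * snapshot p b).trace =
      (ensembleUnitary p * σ * (ensembleUnitary p).conjTranspose) b b := by
    rw [snapshot, ← mul_assoc, Matrix.trace_mul_comm, ← mul_assoc, ← mul_assoc,
      Matrix.trace_mul_single]
    simp
  rw [outcomeProb, e]
  exact (Complex.nonneg_iff.1 h.diag_nonneg).1

/-- The maximum in the definition of the shadow norm is attained. -/
theorem isGreatest_shadowNorm_sq {m : ℕ} (O : Op m) :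
    IsGreatest (secondMoment O '' states m) (shadowNorm O ^ 2) := by
  have hc : Continuous (secondMoment O) := by
    unfold secondMoment outcomeProb
    fun_prop
  have hg := ((isCompact_states m).image hc).isGreatest_sSup ((states_nonempty m).image _)
  have h0 : 0 ≤ sSup (secondMoment O '' states m) := by
    obtain ⟨σ, hσ, h⟩ := hg.1
    rw [← h]
    refine mul_nonneg (by positivity) (Finset.sum_nonneg fun p _ => Finset.sum_nonneg fun b _ => ?_)
    exact mul_nonneg (outcomeProb_nonneg hσ p b) (by positivity)
  rwa [shadowNorm, Real.sq_sqrt h0]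

/-- `λ_{m,k} = (m choose k) / (2m choose 2k)`. -/
def lam (m k : ℕ) : ℝ := (m.choose k : ℝ) / ((2 * m).choose (2 * k) : ℝ)

/-- `λ_{m,k,k',a}`, the quotient of the multinomial coefficients
`(m choose a, k - a, k' - a, m - k - k' + a)` and
`(2m choose 2a, 2(k - a), 2(k' - a), 2(m - k - k' + a))`, for `a ≤ k`, `a ≤ k'` and
`k + k' ≤ m + a`. -/
def lamPair (m k k' a : ℕ) : ℝ :=
  (Nat.multinomial Finset.univ ![a, k - a, k' - a, m + a - (k + k')] : ℝ) /
    (Nat.multinomial Finset.univ ![2 * a, 2 * (k - a), 2 * (k' - a), 2 * (m + a - (k + k'))] : ℝ)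

/-- `κ_{m,μ,μ'} = λ_{m,|μ|/2,|μ'|/2,|μ ∩ μ'|/2} / (λ_{m,|μ|/2} λ_{m,|μ'|/2})` for index sets with
`|μ|`, `|μ'|` and `|μ ∩ μ'|` even; otherwise `0`. -/
def kappa {m : ℕ} (μ ν : Finset (Fin (2 * m))) : ℝ :=
  if Even μ.card ∧ Even ν.card ∧ Even (μ ∩ ν).card then
    lamPair m (μ.card / 2) (ν.card / 2) ((μ ∩ ν).card / 2) /
      (lam m (μ.card / 2) * lam m (ν.card / 2))
  else 0

end
end FermionicShadows

namespace FermionicShadows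

/-! Conjugation by `U(p)` sends `Γ_μ` to `± Γ_{p(μ)}`. In the occupation basis this operator is
diagonal with entries of modulus one if `p(μ)` is a union of modes (`PairClosed`), and has zero
diagonal otherwise; the parities of the single modes detect which case occurs. For fixed `p`, the
sum over outcomes `b` in the channel therefore returns either `Γ_μ` or `0`, so each even `Γ_μ` is an
eigenvector of the channel, with eigenvalue the probability that `p(μ)` is a union of modes
(`channel_majoranaProd`).

Consequently the estimator of `Γ_μ` is its diagonal entry divided by that eigenvalue
(`estimator_majoranaProd`). The triangle inequality bounds the estimator of `H` by a sum of `|h_μ| /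
λ` over those `μ` for which `p(μ)` is a union of modes. This bound does not depend on `b`, and the
outcome probabilities sum to one, so the state disappears. Squaring and averaging over `p` leaves
the probability that `p(μ)` and `p(ν)` are both unions of modes. It vanishes when `|μ ∩ ν|` is odd.

Both probabilities are counts of permutations that make a colouring of the `2m` indices constant on
modes: two colours give `lam`, four colours give `lamPair` (`card_perm_comp_modeOf`). -/

/-- A set of Majorana indices that contains, with an index, its partner in the same mode. -/
def PairClosed {m : ℕ} (S : Finset (Fin (2 * m))) : Prop :=
  ∀ i j, modeOf i = modeOf j → (i ∈ S ↔ j ∈ S)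

/-! ### Permutations relating two colourings of a finite set -/

section Counting

variable {α ι : Type*} [Fintype α] [DecidableEq ι]

/-- Bijections between the fibres of `g` and those of `f`, colour by colour, glue to a permutation.
-/
lemma exists_perm_comp_eq {f g : α → ι}
    (h : ∀ i, (Finset.univ.filter fun a => f a = i).card =
      (Finset.univ.filter fun a => g a = i).card) :
    ∃ σ : Equiv.Perm α, f ∘ σ = g := by
  have e : ∀ i, Nonempty ({a // g a = i} ≃ {a // f a = i}) := fun i => by
    rw [← Fintype.card_eq, Fintype.card_subtype, Fintype.card_subtype, h]
  let E := fun i => (e i).some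
  refine ⟨((Equiv.sigmaFiberEquiv g).symm.trans (Equiv.sigmaCongrRight E)).trans
    (Equiv.sigmaFiberEquiv f), ?_⟩
  ext a
  exact (E (g a) ⟨a, rfl⟩).2

variable [Fintype ι]

/-- The permutations counted form a coset of the stabilizer of `f`, which is the product of the
symmetric groups of the fibres. -/
lemma card_perm_comp_eq [DecidableEq α] {f g : α → ι}
    (h : ∀ i, (Finset.univ.filter fun a => f a = i).card =
      (Finset.univ.filter fun a => g a = i).card) :
    (Finset.univ.filter fun σ : Equiv.Perm α => f ∘ σ = g).card =
      ∏ i, ((Finset.univ.filter fun a => f a = i).card).factorial := by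
  obtain ⟨τ, hτ⟩ := exists_perm_comp_eq h
  have h1 := DomMulAct.stabilizer_card f
  simp only [Fintype.card_subtype] at h1
  rw [← h1]
  refine Finset.card_bij' (fun σ _ => σ * τ⁻¹) (fun σ _ => σ * τ) ?_ ?_ (by simp) (by simp)
  · intro σ hσ
    simp only [Finset.mem_filter, Finset.mem_univ, true_and] at hσ ⊢
    ext a
    have := congrFun (hσ.trans hτ.symm) (τ⁻¹ a)
    simpa using this
  · intro σ hσ
    simp only [Finset.mem_filter, Finset.mem_univ, true_and] at hσ ⊢
    rw [← hτ, Equiv.Perm.coe_mul, ← Function.comp_assoc, hσ]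

lemma exists_card_fibers_eq (n : ι → ℕ) (hn : ∑ i, n i = Fintype.card α) :
    ∃ f : α → ι, ∀ i, (Finset.univ.filter fun a => f a = i).card = n i := by
  have e : Nonempty (α ≃ Σ i, Fin (n i)) := by
    rw [← Fintype.card_eq]; simp [hn]
  obtain ⟨e⟩ := e
  refine ⟨fun a => (e a).1, fun i => ?_⟩
  rw [← Fintype.card_subtype, Fintype.card_congr (e.subtypeEquiv (q := fun x => x.1 = i)
    (fun a => Iff.rfl)), Fintype.card_congr (Equiv.sigmaSubtype i), Fintype.card_fin]

/-- The number of functions with prescribed fibre sizes is a multinomial coefficient. -/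
lemma card_fun_card_fibers_mul [DecidableEq α] (n : ι → ℕ) (hn : ∑ i, n i = Fintype.card α) :
    (Finset.univ.filter fun f : α → ι =>
      ∀ i, (Finset.univ.filter fun a => f a = i).card = n i).card * ∏ i, (n i).factorial =
      (Fintype.card α).factorial := by
  obtain ⟨f, hf⟩ := exists_card_fibers_eq (α := α) n hn
  -- The factorial counts all permutations `σ`. They are sorted by `f ∘ σ`, and each colouring with
  -- the prescribed fibre sizes arises from `∏ i, (n i)!` of them.
  rw [← Fintype.card_perm, ← Finset.card_univ,
    Finset.card_eq_sum_card_fiberwise (f := fun σ : Equiv.Perm α => f ∘ σ)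
    (t := Finset.univ.filter fun g : α → ι =>
      ∀ i, (Finset.univ.filter fun a => g a = i).card = n i)]
  · symm
    rw [Finset.sum_const_nat (m := ∏ i, (n i).factorial)]
    intro g hg
    have hg := (Finset.mem_filter.1 hg).2
    rw [card_perm_comp_eq (fun i => (hf i).trans (hg i).symm)]
    simp only [hf]
  · intro σ _
    simp only [Finset.coe_filter, Finset.mem_univ, true_and, Set.mem_ofPred_eq, Function.comp_apply]
    intro i
    rw [← hf i, ← Finset.card_map σ.toEmbedding]
    congr 1
    ext a
    simp only [Finset.mem_map, Finset.mem_filter, Finset.mem_univ, true_and,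
      Equiv.coe_toEmbedding]
    exact ⟨by rintro ⟨b, hb, rfl⟩; exact hb, fun h => ⟨σ.symm a, by simpa using h, by simp⟩⟩

end Counting

/-! ### Unions of modes and the probabilities `lam` and `lamPair` -/

lemma card_modeOf_fiber {m : ℕ} (s : Finset (Fin m)) :
    (Finset.univ.filter fun k : Fin (2 * m) => modeOf k ∈ s).card = 2 * s.card := by
  rw [Nat.mul_comm 2 s.card, Finset.card_eq_sum_card_fiberwise (f := modeOf) (t := s)]
  · refine Finset.sum_const_nat fun i hi => ?_
    have : (Finset.filter (fun k => modeOf k = i)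
        (Finset.univ.filter fun k : Fin (2 * m) => modeOf k ∈ s)) =
        {⟨2 * i.val, by omega⟩, ⟨2 * i.val + 1, by omega⟩} := by
      ext k
      simp only [Finset.mem_filter, Finset.mem_univ, true_and, Finset.mem_insert,
        Finset.mem_singleton, Fin.ext_iff]
      constructor
      · rintro ⟨-, h⟩
        have : k.val / 2 = i.val := h
        omega
      · intro h
        have h' : modeOf k = i := by ext; change k.val / 2 = i.val; omega
        exact ⟨h' ▸ hi, congrArg Fin.val h'⟩
    rw [this, Finset.card_pair]
    simp [Fin.ext_iff]
  · intro k hk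
    simpa using hk

lemma modeOf_surjective {m : ℕ} : Function.Surjective (modeOf (m := m)) := fun i =>
  ⟨⟨2 * i.val, by omega⟩, by ext; change 2 * i.val / 2 = i.val; omega⟩

open scoped Classical in
/-- The number of permutations that carry a colouring with fibres of sizes `2 n_i` to one that is
constant on modes. -/
lemma card_perm_comp_modeOf {m : ℕ} {ι : Type*} [Fintype ι] (c : Fin (2 * m) → ι) (n : ι → ℕ)
    (hc : ∀ i, (Finset.univ.filter fun k => c k = i).card = 2 * n i) :
    (Finset.univ.filter fun p : Equiv.Perm (Fin (2 * m)) =>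
        ∃ f : Fin m → ι, c ∘ p.symm = f ∘ modeOf).card * ∏ i, (n i).factorial =
      m.factorial * ∏ i, (2 * n i).factorial := by
  have hn : ∑ i, n i = Fintype.card (Fin m) := by
    have := Finset.card_eq_sum_card_fiberwise (f := c) (s := Finset.univ) (t := Finset.univ)
      (by intro; simp)
    simp only [hc, ← Finset.mul_sum, Finset.card_univ, Fintype.card_fin] at this
    rw [Fintype.card_fin]; omega
  have hcard := card_fun_card_fibers_mul (α := Fin m) n hn
  rw [Fintype.card_fin] at hcard
  have hfib : ∀ (f : Fin m → ι) i,
      (Finset.univ.filter fun k : Fin (2 * m) => (f ∘ modeOf) k = i).card =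
        2 * (Finset.univ.filter fun a => f a = i).card := by
    intro f i
    rw [← card_modeOf_fiber]
    simp
  rw [← hcard, mul_right_comm]
  congr 1
  -- There are `m! / ∏ (n i)!` mode colourings `f` with fibre sizes `n i`; each is reached by `∏ (2
  -- * n i)!` permutations. The resulting classes of permutations are disjoint because `modeOf` is
  -- surjective, so that `f ∘ modeOf` determines `f`.
  set F := Finset.univ.filter fun f : Fin m → ι =>
      ∀ i, (Finset.univ.filter fun a => f a = i).card = n i with hF
  have : (Finset.univ.filter fun p : Equiv.Perm (Fin (2 * m)) =>
        ∃ f : Fin m → ι, c ∘ p.symm = f ∘ modeOf) =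
      F.biUnion fun f => Finset.univ.filter fun p : Equiv.Perm (Fin (2 * m)) =>
        c ∘ p.symm = f ∘ modeOf := by
    ext p
    simp only [Finset.mem_filter, Finset.mem_univ, true_and, Finset.mem_biUnion, hF]
    constructor
    · rintro ⟨f, hf⟩
      refine ⟨f, fun i => ?_, hf⟩
      have h1 := hfib f i
      rw [← hf] at h1
      have h2 : (Finset.univ.filter fun k => (c ∘ p.symm) k = i).card =
          (Finset.univ.filter fun k => c k = i).card := by
        rw [← Fintype.card_subtype, ← Fintype.card_subtype]
        exact Fintype.card_congr (p.symm.subtypeEquiv fun a => Iff.rfl)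
      rw [h2, hc] at h1
      omega
    · rintro ⟨f, -, hf⟩
      exact ⟨f, hf⟩
  rw [this, Finset.card_biUnion]
  · refine Finset.sum_const_nat fun f hf => ?_
    have hf := (Finset.mem_filter.1 hf).2
    have h3 := card_perm_comp_eq (f := c) (g := f ∘ modeOf)
      (fun i => by rw [hc, hfib, hf])
    simp only [hc] at h3
    rw [← h3]
    refine Finset.card_bij' (fun p _ => p.symm) (fun p _ => p.symm) ?_ ?_ ?_ ?_ <;> simp
  · intro f _ g _ hfg
    refine Finset.disjoint_left.2 ?_
    intro p hp hq
    simp only [Finset.mem_filter, Finset.mem_univ, true_and] at hp hq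
    exact hfg (modeOf_surjective.injective_comp_right (hp.symm.trans hq))

lemma exists_comp_modeOf_iff {m : ℕ} {ι : Type*} (g : Fin (2 * m) → ι) :
    (∃ f : Fin m → ι, g = f ∘ modeOf) ↔ ∀ i j, modeOf i = modeOf j → g i = g j := by
  constructor
  · rintro ⟨f, rfl⟩ i j h
    simp [h]
  · intro h
    refine ⟨fun i => g (Function.surjInv modeOf_surjective i), funext fun k => h _ _ ?_⟩
    rw [Function.surjInv_eq modeOf_surjective]

lemma pairClosed_map_iff {m : ℕ} (μ : Finset (Fin (2 * m))) (p : Equiv.Perm (Fin (2 * m))) :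
    PairClosed (μ.map p.toEmbedding) ↔
      ∀ i j, modeOf i = modeOf j → (p.symm i ∈ μ ↔ p.symm j ∈ μ) := by
  simp only [PairClosed, Finset.mem_map_equiv]

lemma PairClosed.even_card {m : ℕ} {S : Finset (Fin (2 * m))} (h : PairClosed S) :
    Even S.card := by
  have : S = Finset.univ.filter fun k => modeOf k ∈ S.image modeOf := by
    ext k
    simp only [Finset.mem_filter, Finset.mem_univ, true_and, Finset.mem_image]
    exact ⟨fun hk => ⟨k, hk, rfl⟩, fun ⟨l, hl, hlk⟩ => (h l k hlk).1 hl⟩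
  rw [this, card_modeOf_fiber]
  exact even_two_mul _

lemma PairClosed.inter {m : ℕ} {S T : Finset (Fin (2 * m))} (hS : PairClosed S)
    (hT : PairClosed T) : PairClosed (S ∩ T) := fun i j h => by
  rw [Finset.mem_inter, Finset.mem_inter, hS i j h, hT i j h]

/-- A mode holds two indices, so an even number of them means none or both. This is the form in
which the mode parities see the condition. -/
lemma pairClosed_iff_even_card_filter {m : ℕ} (S : Finset (Fin (2 * m))) :
    PairClosed S ↔ ∀ i, Even (S.filter fun k => modeOf k = i).card := by
  constructor
  · intro h i
    refine PairClosed.even_card fun k l hkl => ?_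
    rw [Finset.mem_filter, Finset.mem_filter, h k l hkl, hkl]
  · intro h
    have key : ∀ i j : Fin (2 * m), modeOf i = modeOf j → i ∈ S → j ∈ S := by
      intro i j hij hi
      by_contra hj
      have : (S.filter fun k => modeOf k = modeOf i) = {i} := by
        ext k
        simp only [Finset.mem_filter, Finset.mem_singleton]
        constructor
        · rintro ⟨hk, hki⟩
          have h1 : k.val / 2 = i.val / 2 := congrArg Fin.val hki
          have h2 : i.val / 2 = j.val / 2 := congrArg Fin.val hij
          have h3 : k.val ≠ j.val := fun e => hj (Fin.ext e ▸ hk)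
          have h4 : i.val ≠ j.val := fun e => hj (Fin.ext e ▸ hi)
          ext; omega
        · rintro rfl
          exact ⟨hi, rfl⟩
      have h1 := h (modeOf i)
      rw [this] at h1
      simp at h1
    exact fun i j hij => ⟨key i j hij, key j i hij.symm⟩

lemma card_le_two_mul {m : ℕ} (S : Finset (Fin (2 * m))) : S.card ≤ 2 * m := by
  simpa using S.card_le_univ

-- The indicator of `μ` is a two-colouring with fibres of sizes `2k` and `2(m - k)`, and `p(μ)` is a
-- union of modes exactly when the transported colouring is constant on modes.
open scoped Classical in
lemma card_pairClosed_map {m : ℕ} {μ : Finset (Fin (2 * m))} (hμ : Even μ.card) :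
    ((Finset.univ.filter fun p : Equiv.Perm (Fin (2 * m)) =>
      PairClosed (μ.map p.toEmbedding)).card : ℝ) =
      (2 * m).factorial * lam m (μ.card / 2) := by
  obtain ⟨k, hk⟩ := hμ.two_dvd
  have hkm : k ≤ m := by have := card_le_two_mul μ; omega
  have h := card_perm_comp_modeOf (fun i => decide (i ∈ μ)) (fun b => if b then k else m - k) (by
    intro b
    cases b
    · simp only [decide_eq_false_iff_not, Finset.filter_not, Finset.filter_mem_eq_inter,
        Finset.univ_inter, Finset.card_sdiff_of_subset (Finset.subset_univ μ)]
      simp [hk]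
      omega
    · simp [hk])
  have hp : ∀ p : Equiv.Perm (Fin (2 * m)), PairClosed (μ.map p.toEmbedding) ↔
      ∃ f : Fin m → Bool, (fun i => decide (i ∈ μ)) ∘ p.symm = f ∘ modeOf := fun p => by
    rw [exists_comp_modeOf_iff, pairClosed_map_iff]
    simp
  simp only [← hp] at h
  simp only [Fintype.prod_bool, if_true, Bool.false_eq_true, if_false] at h
  have h' := congrArg (Nat.cast (R := ℝ)) h
  push_cast at h'
  rw [hk, Nat.mul_div_cancel_left k (by norm_num), lam, Nat.cast_choose ℝ hkm,
    Nat.cast_choose ℝ (by omega : 2 * k ≤ 2 * m), ← Nat.mul_sub]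
  field_simp
  linarith

lemma lam_pos {m k : ℕ} (h : k ≤ m) : 0 < lam m k := by
  have := Nat.choose_pos h
  have := Nat.choose_pos (Nat.mul_le_mul_left 2 h)
  unfold lam
  positivity

/-- Naming the four block sizes removes the truncated subtractions and turns the multinomials into
quotients of factorials. -/
lemma lamPair_eq {m k k' a x y z : ℕ} (hx : k = a + x) (hy : k' = a + y) (hz : m = a + x + y + z) :
    lamPair m k k' a = (m.factorial / (a.factorial * x.factorial * y.factorial * z.factorial)) /
      ((2 * m).factorial / ((2 * a).factorial * (2 * x).factorial * (2 * y).factorial *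
        (2 * z).factorial)) := by
  subst hx hy
  have e1 : a + x - a = x := by omega
  have e2 : a + y - a = y := by omega
  have e3 : m + a - (a + x + (a + y)) = z := by omega
  have e4 : 2 * m = 2 * a + 2 * x + 2 * y + 2 * z := by omega
  have h1 := Nat.multinomial_spec Finset.univ ![a, x, y, z]
  have h2 := Nat.multinomial_spec Finset.univ ![2 * a, 2 * x, 2 * y, 2 * z]
  simp only [Fin.prod_univ_four, Fin.sum_univ_four, Matrix.cons_val] at h1 h2
  rw [← hz] at h1
  rw [← e4] at h2
  rw [lamPair, e1, e2, e3, ← h1, ← h2]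
  push_cast
  congr 1 <;> field_simp

-- Membership in `μ` and in `ν` gives a four-colouring with classes `μ ∩ ν`, `μ \ ν`, `ν \ μ` and
-- the complement of the union. The three parity hypotheses make all four sizes even.
open scoped Classical in
lemma card_pairClosed_map_pair {m : ℕ} {μ ν : Finset (Fin (2 * m))} (hμ : Even μ.card)
    (hν : Even ν.card) (hμν : Even (μ ∩ ν).card) :
    ((Finset.univ.filter fun p : Equiv.Perm (Fin (2 * m)) =>
      PairClosed (μ.map p.toEmbedding) ∧ PairClosed (ν.map p.toEmbedding)).card : ℝ) =
      (2 * m).factorial * lamPair m (μ.card / 2) (ν.card / 2) ((μ ∩ ν).card / 2) := by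
  obtain ⟨k, hk⟩ := hμ.two_dvd
  obtain ⟨k', hk'⟩ := hν.two_dvd
  obtain ⟨a, ha⟩ := hμν.two_dvd
  have c1 := Finset.card_sdiff_add_card_inter μ ν
  have c2 := Finset.card_sdiff_add_card_inter ν μ
  rw [Finset.inter_comm ν μ] at c2
  have c3 := Finset.card_union_add_card_inter μ ν
  have c4 := Finset.card_compl (μ ∪ ν)
  have c5 := card_le_two_mul (μ ∪ ν)
  rw [Fintype.card_fin] at c4
  obtain ⟨x, hx⟩ : ∃ x, k = a + x := ⟨k - a, by omega⟩
  obtain ⟨y, hy⟩ : ∃ y, k' = a + y := ⟨k' - a, by omega⟩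
  obtain ⟨z, hz⟩ : ∃ z, m = a + x + y + z := ⟨m - (a + x + y), by omega⟩
  have h := card_perm_comp_modeOf (fun i => (decide (i ∈ μ), decide (i ∈ ν)))
    (fun b => if b.1 then (if b.2 then a else x) else (if b.2 then y else z)) (by
      rintro ⟨_ | _, _ | _⟩
      · refine (congrArg Finset.card (a₂ := (μ ∪ ν)ᶜ) (by ext; simp)).trans ?_
        simp only [Bool.false_eq_true, if_false]; omega
      · refine (congrArg Finset.card (a₂ := ν \ μ) (by ext; simp [and_comm])).trans ?_
        simp only [if_true, Bool.false_eq_true, if_false]; omega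
      · refine (congrArg Finset.card (a₂ := μ \ ν) (by ext; simp)).trans ?_
        simp only [if_true, Bool.false_eq_true, if_false]; omega
      · refine (congrArg Finset.card (a₂ := μ ∩ ν) (by ext; simp)).trans ?_
        simp; omega)
  have hp : ∀ p : Equiv.Perm (Fin (2 * m)),
      (PairClosed (μ.map p.toEmbedding) ∧ PairClosed (ν.map p.toEmbedding)) ↔
      ∃ f : Fin m → Bool × Bool,
        (fun i => (decide (i ∈ μ), decide (i ∈ ν))) ∘ p.symm = f ∘ modeOf := fun p => by
    rw [exists_comp_modeOf_iff, pairClosed_map_iff, pairClosed_map_iff]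
    simp only [Function.comp_apply, Prod.mk.injEq, decide_eq_decide]
    exact ⟨fun h i j hij => ⟨h.1 i j hij, h.2 i j hij⟩,
      fun h => ⟨fun i j hij => (h i j hij).1, fun i j hij => (h i j hij).2⟩⟩
  simp only [← hp] at h
  simp only [Fintype.prod_prod_type, Fintype.prod_bool, if_true, Bool.false_eq_true,
    if_false] at h
  have h' := congrArg (Nat.cast (R := ℝ)) h
  push_cast at h'
  rw [hk, hk', ha, Nat.mul_div_cancel_left k (by norm_num),
    Nat.mul_div_cancel_left k' (by norm_num), Nat.mul_div_cancel_left a (by norm_num),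
    lamPair_eq hx hy hz]
  field_simp
  linarith


/-! ### Commutation, orthogonality and completeness of the Majorana operators -/

lemma mul_prod_map_majorana {m : ℕ} {A : Op m} {s : Fin (2 * m) → ℂ}
    (h : ∀ k, A * majorana k = s k • (majorana k * A)) (L : List (Fin (2 * m))) :
    A * (L.map majorana).prod = (L.map s).prod • ((L.map majorana).prod * A) := by
  induction L with
  | nil => simp
  | cons k L ih =>
    simp only [List.map_cons, List.prod_cons]
    rw [← mul_assoc, h, smul_mul_assoc, mul_assoc, ih, mul_smul_comm, smul_smul, mul_assoc]

/-- An operator that commutes with each `γ_k` up to a factor `s_k` commutes with `Γ_μ` up to the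
product of these factors. -/
lemma mul_majoranaProd {m : ℕ} {A : Op m} {s : Fin (2 * m) → ℂ}
    (h : ∀ k, A * majorana k = s k • (majorana k * A)) (μ : Finset (Fin (2 * m))) :
    A * majoranaProd μ = (∏ k ∈ μ, s k) • (majoranaProd μ * A) := by
  have : ∏ k ∈ μ, s k = ((μ.sort (· ≤ ·)).map s).prod := by
    rw [← List.prod_toFinset _ (Finset.sort_nodup ..), Finset.sort_toFinset]
  rw [majoranaProd, mul_smul_comm, mul_prod_map_majorana h, this, smul_mul_assoc, smul_comm]

lemma majoranaProd_mem_unitary {m : ℕ} (μ : Finset (Fin (2 * m))) :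
    majoranaProd μ ∈ Matrix.unitaryGroup (Fin m → Bool) ℂ := by
  have h1 : ((μ.sort (· ≤ ·)).map (majorana (m := m))).prod ∈
      Matrix.unitaryGroup (Fin m → Bool) ℂ := by
    refine list_prod_mem fun A hA => ?_
    obtain ⟨k, -, rfl⟩ := List.mem_map.1 hA
    rw [Matrix.mem_unitaryGroup_iff, Matrix.star_eq_conjTranspose, majorana_conjTranspose,
      majorana_mul_self]
  rw [Matrix.mem_unitaryGroup_iff] at h1 ⊢
  rw [majoranaProd, star_smul, smul_mul_smul_comm, h1, star_pow, ← mul_pow]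
  simp

lemma conjTranspose_mul_majoranaProd {m : ℕ} (μ : Finset (Fin (2 * m))) :
    (majoranaProd μ).conjTranspose * majoranaProd μ = 1 :=
  Matrix.mem_unitaryGroup_iff'.1 (majoranaProd_mem_unitary μ)

/-- Inserting `A * A = 1` between the two factors, moving each `A` outwards and cancelling them by
cyclicity multiplies the trace by a scalar other than `1`. -/
lemma trace_conjTranspose_mul_eq_zero {m : ℕ} {A : Op m} {s : Fin (2 * m) → ℂ}
    (hA : A.conjTranspose = A) (hAA : A * A = 1)
    (h : ∀ k, A * majorana k = s k • (majorana k * A)) {μ ν : Finset (Fin (2 * m))}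
    (hs : star (∏ k ∈ μ, s k) * ∏ k ∈ ν, s k ≠ 1) :
    ((majoranaProd μ).conjTranspose * majoranaProd ν).trace = 0 := by
  have h1 := congrArg Matrix.conjTranspose (mul_majoranaProd h μ)
  rw [Matrix.conjTranspose_smul, Matrix.conjTranspose_mul, Matrix.conjTranspose_mul, hA] at h1
  have h2 := mul_majoranaProd h ν
  have h3 : (majoranaProd μ).conjTranspose * majoranaProd ν =
      ((majoranaProd μ).conjTranspose * A) * (A * majoranaProd ν) := by
    rw [mul_assoc, ← mul_assoc A A, hAA, one_mul]
  have h4 : ((majoranaProd μ).conjTranspose * majoranaProd ν).trace =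
      (star (∏ k ∈ μ, s k) * ∏ k ∈ ν, s k) *
        ((majoranaProd μ).conjTranspose * majoranaProd ν).trace := by
    conv_lhs => rw [h3, h1, h2, smul_mul_smul_comm, Matrix.trace_smul, mul_assoc,
      Matrix.trace_mul_comm, mul_assoc, mul_assoc, hAA, mul_one, smul_eq_mul]
  by_contra h0
  exact hs (mul_right_cancel₀ h0 (by rw [one_mul]; exact h4.symm))

lemma majorana_mul_majorana {m : ℕ} (j k : Fin (2 * m)) :
    majorana j * majorana k = (if k = j then (1 : ℂ) else -1) • (majorana k * majorana j) := by
  split_ifs with h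
  · rw [h, one_smul]
  · rw [majorana_anticomm (Ne.symm h), neg_one_smul]

/-- The Majorana operators are orthogonal for the Hilbert-Schmidt inner product. -/
lemma trace_conjTranspose_mul_majoranaProd {m : ℕ} {μ ν : Finset (Fin (2 * m))} (h : μ ≠ ν) :
    ((majoranaProd μ).conjTranspose * majoranaProd ν).trace = 0 := by
  -- For an index `j` in exactly one of the two sets, `γ_j` produces the factor `-(-1) ^ (|μ| +
  -- |ν|)`. This is `-1` only for an even sum; for an odd sum the parity operator supplies the sign
  -- instead.
  rcases Nat.even_or_odd (μ.card + ν.card) with he | ho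
  · have hj : ∃ j, ¬ (j ∈ μ ↔ j ∈ ν) := by
      by_contra! hc
      exact h (Finset.ext hc)
    obtain ⟨j, hj⟩ := hj
    refine trace_conjTranspose_mul_eq_zero (majorana_conjTranspose j) (majorana_mul_self j)
      (majorana_mul_majorana j) ?_
    have hp : ∀ ρ : Finset (Fin (2 * m)), ∏ k ∈ ρ, (if k = j then (1 : ℂ) else -1) =
        (-1) ^ ρ.card * if j ∈ ρ then -1 else 1 := by
      intro ρ
      have : ∀ k, (if k = j then (1 : ℂ) else -1) = (-1) * (if k = j then -1 else 1) := by
        intro k; split_ifs <;> simp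
      simp only [this, Finset.prod_mul_distrib, Finset.prod_const, Finset.prod_ite_eq']
    rw [hp, hp, star_mul', star_pow, star_neg, star_one, mul_mul_mul_comm, ← pow_add,
      he.neg_one_pow]
    by_cases h1 : j ∈ μ <;> by_cases h2 : j ∈ ν <;> simp [h1, h2] at hj ⊢ <;> norm_num
  · refine trace_conjTranspose_mul_eq_zero (parity_conjTranspose m) (parity_mul_self m)
      (s := fun _ => -1) (fun k => by rw [parity_mul_majorana, neg_one_smul]) ?_
    simp only [Finset.prod_const, star_pow, star_neg, star_one]
    rw [← pow_add, ho.neg_one_pow]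
    norm_num

lemma linearIndependent_majoranaProd (m : ℕ) :
    LinearIndependent ℂ (majoranaProd (m := m)) := by
  rw [Fintype.linearIndependent_iff]
  intro g hg μ
  have h1 := congrArg (fun X => ((majoranaProd μ).conjTranspose * X).trace) hg
  simp only [Finset.mul_sum, Matrix.trace_sum, mul_smul_comm, Matrix.trace_smul, mul_zero,
    Matrix.trace_zero] at h1
  rw [Finset.sum_eq_single μ (fun ν _ hν => by
      rw [trace_conjTranspose_mul_majoranaProd (Ne.symm hν), smul_zero]) (by simp),
    conjTranspose_mul_majoranaProd] at h1
  simpa using h1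

/-- There are `2 ^ (2m)` independent operators in a space of dimension `(2 ^ m) ^ 2`. -/
lemma span_majoranaProd (m : ℕ) : Submodule.span ℂ (Set.range (majoranaProd (m := m))) = ⊤ := by
  refine (linearIndependent_majoranaProd m).span_eq_top_of_card_eq_finrank' ?_
  rw [Module.finrank_matrix]
  simp [pow_mul, ← mul_pow]

/-- An operator orthogonal to all odd Majorana operators is even. -/
lemma mem_evenSubspace_of_trace {m : ℕ} {X : Op m}
    (h : ∀ μ : Finset (Fin (2 * m)), ¬ Even μ.card →
      ((majoranaProd μ).conjTranspose * X).trace = 0) : X ∈ evenSubspace m := by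
  have hX : X ∈ Submodule.span ℂ (Set.range (majoranaProd (m := m))) := by
    rw [span_majoranaProd]; trivial
  obtain ⟨c, rfl⟩ := (Submodule.mem_span_range_iff_exists_fun ℂ).1 hX
  refine Submodule.sum_mem _ fun μ _ => ?_
  by_cases hμ : Even μ.card
  · exact Submodule.smul_mem _ _ (Submodule.subset_span ⟨μ, hμ, rfl⟩)
  · have h1 := h μ hμ
    simp only [Finset.mul_sum, Matrix.trace_sum, mul_smul_comm, Matrix.trace_smul] at h1
    rw [Finset.sum_eq_single μ (fun ν _ hν => by
        rw [trace_conjTranspose_mul_majoranaProd (Ne.symm hν), smul_zero]) (by simp),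
      conjTranspose_mul_majoranaProd] at h1
    have : c μ = 0 := by simpa using h1
    rw [this, zero_smul]
    exact Submodule.zero_mem _

/-! ### Diagonals of the rotated Majorana operators -/

noncomputable section

/-- The diagonal operator with entries `(-1) ^ x_i`. -/
def modeParity {m : ℕ} (i : Fin m) : Op m :=
  Matrix.diagonal fun x => if x i = true then (-1 : ℂ) else 1

lemma modeParity_mul_majorana {m : ℕ} (i : Fin m) (k : Fin (2 * m)) :
    modeParity i * majorana k =
      (if modeOf k = i then (-1 : ℂ) else 1) • (majorana k * modeParity i) := by
  ext y x
  rw [Matrix.smul_apply, modeParity, Matrix.diagonal_mul, Matrix.mul_diagonal, majorana_apply]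
  split_ifs <;> simp_all [flipAt, Function.update_apply]

lemma ensembleUnitary_conjTranspose_mul {m : ℕ} (p : Equiv.Perm (Fin (2 * m))) :
    (ensembleUnitary p).conjTranspose * ensembleUnitary p = 1 :=
  Matrix.mem_unitaryGroup_iff'.1 (ensembleUnitary_mem p)

lemma ensembleUnitary_mul_conjTranspose {m : ℕ} (p : Equiv.Perm (Fin (2 * m))) :
    ensembleUnitary p * (ensembleUnitary p).conjTranspose = 1 :=
  Matrix.mem_unitaryGroup_iff.1 (ensembleUnitary_mem p)

/-- The operator `U(p) X U(p)†`. -/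
def rotate {m : ℕ} (p : Equiv.Perm (Fin (2 * m))) (X : Op m) : Op m :=
  ensembleUnitary p * X * (ensembleUnitary p).conjTranspose

lemma rotate_mul {m : ℕ} (p : Equiv.Perm (Fin (2 * m))) (X Y : Op m) :
    rotate p (X * Y) = rotate p X * rotate p Y := by
  unfold rotate
  calc _ = ensembleUnitary p * X * 1 * Y * (ensembleUnitary p).conjTranspose := by
        rw [mul_one, mul_assoc (ensembleUnitary p) X Y]
    _ = _ := by rw [← ensembleUnitary_conjTranspose_mul p]; simp only [mul_assoc]

lemma rotate_smul {m : ℕ} (p : Equiv.Perm (Fin (2 * m))) (c : ℂ) (X : Op m) :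
    rotate p (c • X) = c • rotate p X := by
  simp [rotate]

lemma rotate_one {m : ℕ} (p : Equiv.Perm (Fin (2 * m))) : rotate p 1 = 1 := by
  rw [rotate, mul_one, ensembleUnitary_mul_conjTranspose]

lemma rotate_conjTranspose {m : ℕ} (p : Equiv.Perm (Fin (2 * m))) (X : Op m) :
    rotate p X.conjTranspose = (rotate p X).conjTranspose := by
  simp [rotate, mul_assoc]

lemma conjTranspose_rotate_mul {m : ℕ} (p : Equiv.Perm (Fin (2 * m))) (X : Op m) :
    (ensembleUnitary p).conjTranspose * rotate p X * ensembleUnitary p = X := by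
  rw [rotate]
  calc _ = ((ensembleUnitary p).conjTranspose * ensembleUnitary p) * X *
        ((ensembleUnitary p).conjTranspose * ensembleUnitary p) := by simp only [mul_assoc]
    _ = X := by rw [ensembleUnitary_conjTranspose_mul, one_mul, mul_one]

lemma rotate_conjTranspose_mul {m : ℕ} (p : Equiv.Perm (Fin (2 * m))) (X : Op m) :
    rotate p ((ensembleUnitary p).conjTranspose * X * ensembleUnitary p) = X := by
  rw [rotate]
  calc _ = (ensembleUnitary p * (ensembleUnitary p).conjTranspose) * X *
        (ensembleUnitary p * (ensembleUnitary p).conjTranspose) := by simp only [mul_assoc]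
    _ = X := by rw [ensembleUnitary_mul_conjTranspose, one_mul, mul_one]

lemma trace_mul_snapshot {m : ℕ} (X : Op m) (p : Equiv.Perm (Fin (2 * m))) (b : Fin m → Bool) :
    (X * snapshot p b).trace = rotate p X b b := by
  rw [rotate, snapshot, ← mul_assoc, Matrix.trace_mul_comm, ← mul_assoc, ← mul_assoc,
    Matrix.trace_mul_single]
  simp

/-- The mode parity is pulled back through `U(p)` and commuted past the factors of `Γ_μ` there. The
sign relating `U(p) Γ_μ U(p)†` to `Γ_{p(μ)}` thus never has to be computed. -/
lemma modeParity_mul_rotate {m : ℕ} (i : Fin m) (p : Equiv.Perm (Fin (2 * m)))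
    (μ : Finset (Fin (2 * m))) :
    modeParity i * rotate p (majoranaProd μ) =
      (-1 : ℂ) ^ ((μ.map p.toEmbedding).filter fun k => modeOf k = i).card •
        (rotate p (majoranaProd μ) * modeParity i) := by
  obtain ⟨A, hrA⟩ : ∃ A, rotate p A = modeParity i := ⟨_, rotate_conjTranspose_mul p _⟩
  have h : ∀ k, A * majorana k =
      (if modeOf (p k) = i then (-1 : ℂ) else 1) • (majorana k * A) := by
    intro k
    rw [← conjTranspose_rotate_mul p (A * majorana k), rotate_mul, hrA,
      show rotate p (majorana k) = majorana (p k) from ensembleUnitary_conj p k,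
      modeParity_mul_majorana, ← show rotate p (majorana k) = majorana (p k) from
      ensembleUnitary_conj p k, ← hrA, ← rotate_mul, ← rotate_smul, conjTranspose_rotate_mul]
  have h1 := congrArg (rotate p) (mul_majoranaProd h μ)
  rw [rotate_mul, rotate_smul, rotate_mul, hrA] at h1
  rw [h1, Finset.prod_ite, Finset.prod_const, Finset.prod_const_one, mul_one, Finset.filter_map,
    Finset.card_map]
  rfl

/-- The diagonal entries of `U(p) Γ_μ U(p)†`. -/
def diagCoeff {m : ℕ} (p : Equiv.Perm (Fin (2 * m))) (μ : Finset (Fin (2 * m)))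
    (b : Fin m → Bool) : ℂ := rotate p (majoranaProd μ) b b

/-- Some mode meets `p(μ)` in one index, so the rotated operator anticommutes with a diagonal matrix
of signs. -/
lemma diagCoeff_eq_zero {m : ℕ} {p : Equiv.Perm (Fin (2 * m))} {μ : Finset (Fin (2 * m))}
    (h : ¬ PairClosed (μ.map p.toEmbedding)) (b : Fin m → Bool) : diagCoeff p μ b = 0 := by
  rw [pairClosed_iff_even_card_filter] at h
  push Not at h
  obtain ⟨i, hi⟩ := h
  have h1 := congrFun (congrFun (modeParity_mul_rotate i p μ) b) b
  rw [(Nat.not_even_iff_odd.1 hi).neg_one_pow, modeParity, Matrix.smul_apply,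
    Matrix.diagonal_mul, Matrix.mul_diagonal] at h1
  unfold diagCoeff
  split_ifs at h1
  · linear_combination (-1 / 2 : ℂ) * h1
  · linear_combination (1 / 2 : ℂ) * h1

/-- The rotated operator commutes with every mode parity, and these separate the basis states. -/
lemma rotate_majoranaProd_eq_diagonal {m : ℕ} {p : Equiv.Perm (Fin (2 * m))}
    {μ : Finset (Fin (2 * m))} (h : PairClosed (μ.map p.toEmbedding)) :
    rotate p (majoranaProd μ) = Matrix.diagonal (diagCoeff p μ) := by
  ext y x
  by_cases hyx : y = x
  · rw [hyx, Matrix.diagonal_apply_eq, diagCoeff]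
  · rw [Matrix.diagonal_apply_ne _ hyx]
    obtain ⟨i, hi⟩ := Function.ne_iff.1 hyx
    have h1 := congrFun (congrFun (modeParity_mul_rotate i p μ) y) x
    rw [((pairClosed_iff_even_card_filter _).1 h i).neg_one_pow, modeParity, one_smul,
      Matrix.diagonal_mul, Matrix.mul_diagonal] at h1
    cases hy : y i <;> cases hx : x i <;> simp [hy, hx] at hi h1
    · exact self_eq_neg.1 h1
    · exact neg_eq_self.1 h1

/-- The rotated operator is both diagonal and unitary. -/
lemma norm_diagCoeff {m : ℕ} {p : Equiv.Perm (Fin (2 * m))} {μ : Finset (Fin (2 * m))}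
    (h : PairClosed (μ.map p.toEmbedding)) (b : Fin m → Bool) : ‖diagCoeff p μ b‖ = 1 := by
  have h1 := congrArg (rotate p) (conjTranspose_mul_majoranaProd μ)
  rw [rotate_mul, rotate_conjTranspose, rotate_one, rotate_majoranaProd_eq_diagonal h,
    Matrix.diagonal_conjTranspose, Matrix.diagonal_mul_diagonal] at h1
  have h2 := congrFun (congrFun h1 b) b
  rw [Matrix.diagonal_apply_eq, Matrix.one_apply_eq, Pi.star_apply] at h2
  have h3 := congrArg norm h2
  rw [norm_mul, norm_star, norm_one] at h3
  nlinarith [norm_nonneg (diagCoeff p μ b)]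

lemma sum_diagCoeff_smul_snapshot {m : ℕ} {p : Equiv.Perm (Fin (2 * m))}
    {μ : Finset (Fin (2 * m))} (h : PairClosed (μ.map p.toEmbedding)) :
    ∑ b, diagCoeff p μ b • snapshot p b = majoranaProd μ := by
  rw [← conjTranspose_rotate_mul p (majoranaProd μ), rotate_majoranaProd_eq_diagonal h,
    ← Matrix.sum_single_eq_diagonal, Finset.mul_sum, Finset.sum_mul]
  refine Finset.sum_congr rfl fun b _ => ?_
  rw [snapshot, ← smul_mul_assoc, ← mul_smul_comm, Matrix.smul_single, smul_eq_mul, mul_one]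

/-- A union of modes has even size, so the rotated odd operators have zero diagonal. Membership is
what makes `channelInv` a genuine preimage at snapshots. -/
lemma snapshot_mem_evenSubspace {m : ℕ} (p : Equiv.Perm (Fin (2 * m))) (b : Fin m → Bool) :
    snapshot p b ∈ evenSubspace m := by
  refine mem_evenSubspace_of_trace fun μ hμ => ?_
  rw [trace_mul_snapshot, rotate_conjTranspose, Matrix.conjTranspose_apply]
  have : diagCoeff p μ b = 0 := diagCoeff_eq_zero (fun h => hμ (by simpa using h.even_card)) b
  rw [diagCoeff] at this
  rw [this, star_zero]

/-! ### Spectrum and inverse of the channel -/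

/-- For each `p` the sum over outcomes is `Γ_μ` or `0`, according to whether `p(μ)` is a union of
modes; the eigenvalue is the proportion of favourable `p`. -/
lemma channel_majoranaProd {m : ℕ} {μ : Finset (Fin (2 * m))} (hμ : Even μ.card) :
    channel (majoranaProd μ) = (lam m (μ.card / 2) : ℂ) • majoranaProd μ := by
  classical
  have h1 : ∀ p : Equiv.Perm (Fin (2 * m)),
      ∑ b, (majoranaProd μ * snapshot p b).trace • snapshot p b =
        if PairClosed (μ.map p.toEmbedding) then majoranaProd μ else 0 := by
    intro p
    simp only [trace_mul_snapshot]
    split_ifs with h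
    · exact sum_diagCoeff_smul_snapshot h
    · exact Finset.sum_eq_zero fun b _ => by
        rw [show rotate p (majoranaProd μ) b b = 0 from diagCoeff_eq_zero h b, zero_smul]
  have h2 := congrArg (Complex.ofReal) (card_pairClosed_map hμ)
  push_cast at h2
  have h0 : ((2 * m).factorial : ℂ) ≠ 0 := Nat.cast_ne_zero.2 (Nat.factorial_ne_zero _)
  rw [channel, Finset.sum_congr rfl fun p _ => h1 p, Finset.sum_ite, Finset.sum_const_zero,
    add_zero, Finset.sum_const, ← Nat.cast_smul_eq_nsmul ℂ, smul_smul, h2, inv_mul_cancel_left₀ h0]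

/-- The channel as a linear map. -/
def channelLinear (m : ℕ) : Op m →ₗ[ℂ] Op m where
  toFun := channel
  map_add' X Y := by
    simp only [channel, add_mul, Matrix.trace_add, add_smul, Finset.sum_add_distrib, smul_add]
  map_smul' c X := by
    simp only [channel, smul_mul_assoc, Matrix.trace_smul, RingHom.id_apply, smul_assoc,
      ← Finset.smul_sum]
    rw [smul_comm]

lemma channelLinear_apply {m : ℕ} (X : Op m) : channelLinear m X = channel X := rfl

/-- The channel is self-adjoint for the trace form. -/
lemma trace_channel_mul {m : ℕ} (X Y : Op m) :
    (channel X * Y).trace = (X * channel Y).trace := by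
  simp only [channel, smul_mul_assoc, mul_smul_comm, Finset.sum_mul, Finset.mul_sum,
    Matrix.trace_smul, Matrix.trace_sum, smul_eq_mul]
  refine Finset.sum_congr rfl fun p _ => Finset.sum_congr rfl fun b _ => ?_
  rw [Matrix.trace_mul_comm (snapshot p b) Y]
  ring

lemma lam_card_div_two_pos {m : ℕ} (μ : Finset (Fin (2 * m))) : 0 < lam m (μ.card / 2) :=
  lam_pos (by have := card_le_two_mul μ; omega)

lemma channel_mem_evenSubspace {m : ℕ} {X : Op m} (hX : X ∈ evenSubspace m) :
    channel X ∈ evenSubspace m := by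
  have : evenSubspace m ≤ (evenSubspace m).comap (channelLinear m) := by
    refine Submodule.span_le.2 ?_
    rintro _ ⟨μ, hμ, rfl⟩
    change channel _ ∈ evenSubspace m
    rw [channel_majoranaProd hμ]
    exact Submodule.smul_mem _ _ (Submodule.subset_span ⟨μ, hμ, rfl⟩)
  exact this hX

/-- The spanning eigenvectors have nonzero eigenvalues, which gives surjectivity; injectivity
follows by finite dimension. -/
theorem channel_bijOn (m : ℕ) :
    Set.BijOn (channel (m := m)) (evenSubspace m : Set (Op m)) (evenSubspace m : Set (Op m)) := by
  have hle : evenSubspace m ≤ (evenSubspace m).map (channelLinear m) := by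
    refine Submodule.span_le.2 ?_
    rintro _ ⟨μ, hμ, rfl⟩
    have h0 : (lam m (μ.card / 2) : ℂ) ≠ 0 :=
      Complex.ofReal_ne_zero.2 (lam_card_div_two_pos μ).ne'
    refine ⟨(lam m (μ.card / 2) : ℂ)⁻¹ • majoranaProd μ,
      Submodule.smul_mem _ _ (Submodule.subset_span ⟨μ, hμ, rfl⟩), ?_⟩
    rw [map_smul, channelLinear_apply, channel_majoranaProd hμ, inv_smul_smul₀ h0]
  set f : evenSubspace m →ₗ[ℂ] evenSubspace m :=
    (channelLinear m).restrict fun _ hX => channel_mem_evenSubspace hX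
  have hf : Function.Surjective f := by
    rintro ⟨Y, hY⟩
    obtain ⟨X, hX, rfl⟩ := hle hY
    exact ⟨⟨X, hX⟩, rfl⟩
  have hi : Function.Injective f := LinearMap.injective_iff_surjective.2 hf
  refine ⟨fun X hX => channel_mem_evenSubspace hX, fun X hX Y hY hXY => ?_, fun Y hY => hle hY⟩
  exact congrArg Subtype.val (@hi ⟨X, hX⟩ ⟨Y, hY⟩ (Subtype.ext hXY))

lemma channel_channelInv_snapshot {m : ℕ} (p : Equiv.Perm (Fin (2 * m))) (b : Fin m → Bool) :
    channel (channelInv (snapshot p b)) = snapshot p b :=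
  Function.invFunOn_eq ((channel_bijOn m).surjOn (snapshot_mem_evenSubspace p b))

/-- Self-adjointness moves the channel from `channelInv (snapshot p b)` onto `Γ_μ`, where it acts as
the scalar `lam`. No formula for the inverse is needed. -/
lemma estimator_majoranaProd {m : ℕ} {μ : Finset (Fin (2 * m))} (hμ : Even μ.card)
    (p : Equiv.Perm (Fin (2 * m))) (b : Fin m → Bool) :
    estimator (majoranaProd μ) p b = (lam m (μ.card / 2) : ℂ)⁻¹ * diagCoeff p μ b := by
  have h0 : (lam m (μ.card / 2) : ℂ) ≠ 0 :=
    Complex.ofReal_ne_zero.2 (lam_card_div_two_pos μ).ne'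
  have h1 := trace_channel_mul (majoranaProd μ) (channelInv (snapshot p b))
  rw [channel_channelInv_snapshot, channel_majoranaProd hμ, smul_mul_assoc, Matrix.trace_smul,
    trace_mul_snapshot, smul_eq_mul] at h1
  rw [diagCoeff, ← h1, inv_mul_cancel_left₀ h0, estimator]

/-! ### The second moment -/

-- The triangle inequality, with diagonal entries of modulus one or zero. The right-hand side is
-- independent of `b`.
open scoped Classical in
lemma norm_estimator_le {m : ℕ} (h : Finset (Fin (2 * m)) → ℂ) (p : Equiv.Perm (Fin (2 * m)))
    (b : Fin m → Bool) :
    ‖estimator (∑ μ : Finset (Fin (2 * m)) with Even μ.card, h μ • majoranaProd μ) p b‖ ≤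
      ∑ μ : Finset (Fin (2 * m)) with Even μ.card, ‖h μ‖ * (lam m (μ.card / 2))⁻¹ *
        if PairClosed (μ.map p.toEmbedding) then 1 else 0 := by
  rw [estimator, Finset.sum_mul, Matrix.trace_sum]
  refine norm_sum_le_of_le _ fun μ hμ => ?_
  have h1 := estimator_majoranaProd (Finset.mem_filter.1 hμ).2 p b
  rw [estimator] at h1
  rw [smul_mul_assoc, Matrix.trace_smul, h1, smul_eq_mul, norm_mul, norm_mul, norm_inv,
    Complex.norm_real, Real.norm_of_nonneg (lam_card_div_two_pos μ).le, mul_assoc]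
  split_ifs with hp
  · rw [norm_diagCoeff hp]
  · rw [diagCoeff_eq_zero hp, norm_zero]

lemma sum_outcomeProb {m : ℕ} {σ : Op m} (hσ : σ ∈ states m) (p : Equiv.Perm (Fin (2 * m))) :
    ∑ b, outcomeProb σ p b = 1 := by
  simp only [outcomeProb, trace_mul_snapshot, ← Complex.re_sum]
  have : ∑ b, rotate p σ b b = (rotate p σ).trace := rfl
  rw [this, rotate, Matrix.trace_mul_comm, ← mul_assoc, ensembleUnitary_conjTranspose_mul, one_mul,
    hσ.2, Complex.one_re]

open scoped Classical in
lemma card_pairClosed_map_pair_div {m : ℕ} {μ ν : Finset (Fin (2 * m))} (hμ : Even μ.card)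
    (hν : Even ν.card) :
    ((2 * m).factorial : ℝ)⁻¹ * ∑ p : Equiv.Perm (Fin (2 * m)),
      ((lam m (μ.card / 2))⁻¹ * (if PairClosed (μ.map p.toEmbedding) then 1 else 0)) *
        ((lam m (ν.card / 2))⁻¹ * if PairClosed (ν.map p.toEmbedding) then 1 else 0) =
      kappa μ ν := by
  have h0 : ((2 * m).factorial : ℝ) ≠ 0 := Nat.cast_ne_zero.2 (Nat.factorial_ne_zero _)
  have e : ∀ p : Equiv.Perm (Fin (2 * m)),
      ((lam m (μ.card / 2))⁻¹ * (if PairClosed (μ.map p.toEmbedding) then (1 : ℝ) else 0)) *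
        ((lam m (ν.card / 2))⁻¹ * if PairClosed (ν.map p.toEmbedding) then 1 else 0) =
      ((lam m (μ.card / 2))⁻¹ * (lam m (ν.card / 2))⁻¹) *
        if PairClosed (μ.map p.toEmbedding) ∧ PairClosed (ν.map p.toEmbedding) then 1 else 0 := by
    intro p
    by_cases h1 : PairClosed (μ.map p.toEmbedding) <;>
      by_cases h2 : PairClosed (ν.map p.toEmbedding) <;> simp [h1, h2]
  rw [Finset.sum_congr rfl fun p _ => e p, ← Finset.mul_sum, Finset.sum_boole, kappa]
  split_ifs with h
  · rw [card_pairClosed_map_pair hμ hν h.2.2]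
    field_simp
  -- For an odd intersection no `p` qualifies: two unions of modes intersect in a union of modes,
  -- which has even size. This matches the value `0` in `kappa`.
  · rw [Finset.filter_false_of_mem, Finset.card_empty, Nat.cast_zero, mul_zero, mul_zero]
    rintro p - ⟨h1, h2⟩
    refine h ⟨hμ, hν, ?_⟩
    have := (h1.inter h2).even_card
    rwa [← Finset.map_inter, Finset.card_map] at this

lemma secondMoment_le {m : ℕ} (h : Finset (Fin (2 * m)) → ℂ) {σ : Op m} (hσ : σ ∈ states m) :
    secondMoment (∑ μ : Finset (Fin (2 * m)) with Even μ.card, h μ • majoranaProd μ) σ ≤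
      ∑ μ : Finset (Fin (2 * m)) with Even μ.card, ∑ ν : Finset (Fin (2 * m)) with Even ν.card,
        ‖h μ‖ * ‖h ν‖ * kappa μ ν := by
  classical
  set B : Equiv.Perm (Fin (2 * m)) → ℝ := fun p =>
    ∑ μ : Finset (Fin (2 * m)) with Even μ.card, ‖h μ‖ * (lam m (μ.card / 2))⁻¹ *
        if PairClosed (μ.map p.toEmbedding) then 1 else 0 with hB
  have h1 : ∀ p : Equiv.Perm (Fin (2 * m)), ∑ b, outcomeProb σ p b *
      ‖estimator (∑ μ : Finset (Fin (2 * m)) with Even μ.card, h μ • majoranaProd μ) p b‖ ^ 2 ≤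
      B p * B p := by
    intro p
    -- The factor `1` is written as the total outcome probability, which allows a comparison outcome
    -- by outcome and eliminates `σ`.
    rw [← one_mul (B p * B p), ← sum_outcomeProb hσ p, Finset.sum_mul]
    refine Finset.sum_le_sum fun b _ => mul_le_mul_of_nonneg_left ?_ (outcomeProb_nonneg hσ p b)
    rw [← pow_two]
    exact pow_le_pow_left₀ (norm_nonneg _) (norm_estimator_le h p b) 2
  refine (mul_le_mul_of_nonneg_left (Finset.sum_le_sum fun p _ => h1 p) (by positivity)).trans_eq ?_
  simp only [hB, Finset.sum_mul_sum]
  rw [Finset.sum_comm, Finset.mul_sum]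
  refine Finset.sum_congr rfl fun μ hμ => ?_
  rw [Finset.sum_comm, Finset.mul_sum]
  refine Finset.sum_congr rfl fun ν hν => ?_
  rw [← card_pairClosed_map_pair_div (Finset.mem_filter.1 hμ).2 (Finset.mem_filter.1 hν).2,
    Finset.mul_sum, Finset.mul_sum, Finset.mul_sum]
  exact Finset.sum_congr rfl fun p _ => by ring

end
end FermionicShadows

open FermionicShadows in
theorem mainTheorem7 (m : ℕ) (h : Finset (Fin (2 * m)) → ℂ) (H : FermionicShadows.Op m)
    (hH : H = ∑ μ : Finset (Fin (2 * m)) with Even μ.card,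
      h μ • FermionicShadows.majoranaProd μ) :
    Set.BijOn (FermionicShadows.channel (m := m))
        (FermionicShadows.evenSubspace m : Set (FermionicShadows.Op m))
        (FermionicShadows.evenSubspace m : Set (FermionicShadows.Op m)) ∧
      FermionicShadows.shadowNorm H ^ 2 ≤
        ∑ μ : Finset (Fin (2 * m)) with Even μ.card,
          ∑ ν : Finset (Fin (2 * m)) with Even ν.card ∧ Even (μ ∩ ν).card,
            ‖h μ‖ * ‖h ν‖ * FermionicShadows.kappa μ ν := by
  refine ⟨channel_bijOn m, ?_⟩
  -- Since the maximum is attained, a bound valid for every state bounds the shadow norm.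
  obtain ⟨σ, hσ, hσH⟩ := (isGreatest_shadowNorm_sq H).1
  rw [← hσH, hH]
  refine (secondMoment_le h hσ).trans_eq (Finset.sum_congr rfl fun μ _ => ?_)
  -- Restricting to even intersections drops only terms in which `kappa` is zero.
  rw [← Finset.filter_filter]
  refine (Finset.sum_filter_of_ne ?_).symm
  intro ν _ hne
  by_contra hν
  exact hne (by rw [kappa, if_neg (fun hc => hν hc.2.2), mul_zero])
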